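/- Let $H$ be a complex Hilbert space with norm $|\cdot|$ and inner product $\langle\cdot,\cdot\rangle$, and let $-A$, with domain $D(A)$, be the generator of a uniformly bounded holomorphic semigroup $e^{-tA}$ on $H$; that is, $\|e^{-tA}\|\le M$ for some $M$ and all $t\ge 0$, and $e^{-zA}$ is a holomorphic semigroup in some sector $\{z\ne0: |\arg z|<\delta\}$ with $0<\delta<\pi/2$. Write $D(A^2)=\{x\in D(A): Ax\in D(A)\}$, $\nu(A)=\{\langle Ax,x\rangle: x\in D(A),\ |x|=1\}$, $m(A)=\inf\operatorname{Re}\nu(A)$, and, for $u_0\in H$, $h(t)=|e^{-tA}u_0|$ for $t\ge0$. Then the following are equivalent: (i) $2(\operatorname{Re}\langle Ax,x\rangle)^2\le \operatorname{Re}\langle A^2x,x\rangle+|Ax|^2$ for every $x\in D(A^2)$ with $|x|=1$; (ii) for every $u_0\neq0$ the function $h$ is log-convex on $[0,\infty)$, that is, $h(s)\le h(r)^{\frac{t-s}{t-r}}\,h(t)^{\frac{s-r}{t-r}}$ whenever $0\le r<s<t$. If $A$ has the equivalent properties (i) and (ii) and moreover $\nu(A)\subset\{z\in\mathbb{C}:\operatorname{Re}z>0\}$,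 then for every $u_0\ne0$ the function $h$ is strictly decreasing and strictly convex on $[0,\infty)$, differentiable on $(0,\infty)$, and differentiable from the right at $0$ in the extended sense, with derivative $h'(0)=\lim_{t\to0^+}(h(t)-h(0))/t\in[-\infty,0]$ satisfying $h'(0)=\inf_{t>0}h'(t)$, and $h'(0)\le -m(A)$ if $|u_0|=1$. If in addition $u_0\in D(A)$ and $|u_0|=1$, then $h'(0)=-\operatorname{Re}\langle Au_0,u_0\rangle$ and $h\in C^1([0,\infty))\cap C^\infty((0,\infty))$. -/

import Mathlib

open Filter Topology Set
open scoped ContDiff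

noncomputable section

namespace HolSemigroup

/-- The open sector `{z ≠ 0 : -δ < arg z < δ}`. -/
def sector (δ : ℝ) : Set ℂ := {z | z ≠ 0 ∧ |z.arg| < δ}

/-- `T` is a holomorphic semigroup of bounded operators in the sector of half-angle `δ`.
The values of `T` outside the sector and its vertex are irrelevant. -/
structure IsHolomorphicOn {H : Type*} [NormedAddCommGroup H] [InnerProductSpace ℂ H]
    (T : ℂ → H →L[ℂ] H) (δ : ℝ) : Prop where
  map_zero : T 0 = ContinuousLinearMap.id ℂ H
  map_add : ∀ z ∈ sector δ, ∀ w ∈ sector δ, T (z + w) = (T z).comp (T w)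
  holomorphic : DifferentiableOn ℂ T (sector δ)
  tendsto_zero : ∀ x : H, Tendsto (fun z => T z x) (𝓝[sector δ] 0) (𝓝 x)

/-- `T` is a uniformly bounded holomorphic semigroup: it is holomorphic in some sector around
the positive real axis, and it is bounded in operator norm for real times `t ≥ 0`. -/
def IsBoundedHolomorphic {H : Type*} [NormedAddCommGroup H] [InnerProductSpace ℂ H]
    (T : ℂ → H →L[ℂ] H) : Prop :=
  (∃ δ : ℝ, 0 < δ ∧ δ < Real.pi / 2 ∧ IsHolomorphicOn T δ) ∧
    ∃ M : ℝ, ∀ t : ℝ, 0 ≤ t → ‖T (t : ℂ)‖ ≤ M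

/-- The (unbounded) operator `B` is the infinitesimal generator of `T`: its domain consists of
exactly those `x` for which `(T t x - x) / t` has a limit as `t → 0⁺`, and `B x` is that limit. -/
def IsGenerator {H : Type*} [NormedAddCommGroup H] [InnerProductSpace ℂ H]
    (B : H →ₗ.[ℂ] H) (T : ℂ → H →L[ℂ] H) : Prop :=
  ∀ x y : H, (∃ hx : x ∈ B.domain, B ⟨x, hx⟩ = y) ↔
    Tendsto (fun t : ℝ => t⁻¹ • (T (t : ℂ) x - x)) (𝓝[>] 0) (𝓝 y)

/-- The numerical range `ν(A) = {⟨A x, x⟩ : x ∈ D(A), |x| = 1}`. Mathlib's inner product is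
linear in its second argument. -/
def numericalRange {H : Type*} [NormedAddCommGroup H] [InnerProductSpace ℂ H]
    (A : H →ₗ.[ℂ] H) : Set ℂ :=
  {z | ∃ x : A.domain, ‖(x : H)‖ = 1 ∧ z = inner ℂ (x : H) (A x)}

/-- The lower bound `m(A) = inf Re ν(A)`, as an extended real number. -/
def lowerBound {H : Type*} [NormedAddCommGroup H] [InnerProductSpace ℂ H]
    (A : H →ₗ.[ℂ] H) : EReal :=
  sInf ((fun z : ℂ => (z.re : EReal)) '' numericalRange A)

/-- `ν(A)` is contained in the open right half-plane. -/
def IsPositivelyAccretive {H : Type*} [NormedAddCommGroup H] [InnerProductSpace ℂ H]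
    (A : H →ₗ.[ℂ] H) : Prop :=
  numericalRange A ⊆ {z : ℂ | 0 < z.re}

/-- `2 (Re ⟨A x, x⟩)² ≤ Re ⟨A² x, x⟩ + |A x|²` for all unit vectors `x ∈ D(A²)`, where
`D(A²) = {x ∈ D(A) : A x ∈ D(A)}`. -/
def LogConvexityCriterion {H : Type*} [NormedAddCommGroup H] [InnerProductSpace ℂ H]
    (A : H →ₗ.[ℂ] H) : Prop :=
  ∀ (x : A.domain) (hx : A x ∈ A.domain), ‖(x : H)‖ = 1 →
    2 * (inner ℂ (x : H) (A x)).re ^ 2 ≤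
      (inner ℂ (x : H) (A ⟨A x, hx⟩)).re + ‖A x‖ ^ 2

/-- The height function `h(t) = |T t u₀|`, of interest for `t ≥ 0`. -/
def height {H : Type*} [NormedAddCommGroup H] [InnerProductSpace ℂ H]
    (T : ℂ → H →L[ℂ] H) (u₀ : H) : ℝ → ℝ :=
  fun t => ‖T (t : ℂ) u₀‖

/-- Log-convexity of a non-negative function on the closed half-line `[0, ∞)`. -/
def LogConvexOnHalfLine (f : ℝ → ℝ) : Prop :=
  ∀ r s t : ℝ, 0 ≤ r → r < s → s < t →
    f s ≤ f r ^ ((t - s) / (t - r)) * f t ^ ((s - r) / (t - r))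

/-- `f` has the extended real number `L` as its derivative from the right at `a`. -/
def HasExtendedRightDeriv (f : ℝ → ℝ) (L : EReal) (a : ℝ) : Prop :=
  Tendsto (fun t : ℝ => (((f t - f a) / (t - a) : ℝ) : EReal)) (𝓝[>] a) (𝓝 L)

end HolSemigroup

end

/-! For `u₀ ≠ 0` the orbit `u(t) = T t u₀` is real-analytic on `t > 0` and never vanishes, so `log
h` is smooth there, and with the real inner product `Re⟨·,·⟩` `(log h)'' = ((⟨u, u''⟩ + |u'|²)|u|² -
2⟨u, u'⟩²) / |u|⁴`. Since `u' = -Au` and `u'' = A²u`, nonnegativity of the numerator is criterion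
(i) at `u(t)`, made homogeneous of degree four. Hence (i) makes `log h` convex
(`LogConvexityCriterion.convexOn_log_height`); conversely, convexity gives the inequality along
orbits, and `t → 0⁺` with `u₀ ∈ D(A²)` recovers (i)
(`logConvexityCriterion_of_convexOn_log_height`).

Accretivity gives `h h' = -Re⟨Au, u⟩ < 0`, so `h` strictly decreases; being injective and
log-convex, it is strictly convex. Monotone difference quotients then yield the extended derivative
at `0`, and `h' ≤ -m(A) h` bounds it. -/

namespace HolSemigroup

attribute [local instance] InnerProductSpace.complexToReal

/-! ### Derivatives of the norm of a curve and of its logarithm. -/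

section LogNorm

variable {F : Type*} [NormedAddCommGroup F] [InnerProductSpace ℝ F]

lemma hasDerivAt_log_norm {f : ℝ → F} {f' : F} {t : ℝ} (hf : HasDerivAt f f' t) (h0 : f t ≠ 0) :
    HasDerivAt (fun s => Real.log ‖f s‖) (inner ℝ (f t) f' / ‖f t‖ ^ 2) t := by
  have hn : ‖f t‖ ≠ 0 := norm_ne_zero_iff.2 h0
  have h := ((hf.norm_sq).log (pow_ne_zero 2 hn)).const_mul (1 / 2 : ℝ)
  have e : (fun s => Real.log ‖f s‖) = fun s => 1 / 2 * Real.log (‖f s‖ ^ 2) := by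
    ext s
    rw [Real.log_pow]
    push_cast
    ring
  rw [e]
  exact h.congr_deriv (by ring)

lemma hasDerivWithinAt_norm {f : ℝ → F} {f' : F} {s : Set ℝ} {t : ℝ}
    (hf : HasDerivWithinAt f f' s t) (h0 : f t ≠ 0) :
    HasDerivWithinAt (fun s => ‖f s‖) (inner ℝ (f t) f' / ‖f t‖) s t := by
  have hn : ‖f t‖ ≠ 0 := norm_ne_zero_iff.2 h0
  have h := (hf.norm_sq).sqrt (pow_ne_zero 2 hn)
  simp only [Real.sqrt_sq (norm_nonneg _)] at h
  exact h.congr_deriv (by field_simp)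

lemma hasDerivAt_inner_div_norm_sq {f g : ℝ → F} {f' : F} {t : ℝ}
    (hf : HasDerivAt f (g t) t) (hg : HasDerivAt g f' t) (h0 : f t ≠ 0) :
    HasDerivAt (fun s => inner ℝ (f s) (g s) / ‖f s‖ ^ 2)
      (((inner ℝ (f t) f' + ‖g t‖ ^ 2) * ‖f t‖ ^ 2 - 2 * inner ℝ (f t) (g t) ^ 2) /
        (‖f t‖ ^ 2) ^ 2) t := by
  have hn : ‖f t‖ ≠ 0 := norm_ne_zero_iff.2 h0
  have h := (hf.inner ℝ hg).div hf.norm_sq (pow_ne_zero 2 hn)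
  refine h.congr_deriv ?_
  rw [real_inner_self_eq_norm_sq]
  ring

end LogNorm

/-! ### Log-convexity and convex functions on the half-line. -/

section Convexity

lemma convexOn_log_of_logConvex {f : ℝ → ℝ} (hpos : ∀ t, 0 ≤ t → 0 < f t)
    (hf : LogConvexOnHalfLine f) : ConvexOn ℝ (Ici 0) (fun t => Real.log (f t)) := by
  refine LinearOrder.convexOn_of_lt (convex_Ici 0) fun r hr t ht hrt a b ha hb hab => ?_
  have hr0 : (0 : ℝ) ≤ r := hr
  have ht0 : (0 : ℝ) ≤ t := ht
  have hd : 0 < t - r := sub_pos.2 hrt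
  have hs1 : r < a • r + b • t := by
    simp only [smul_eq_mul]; nlinarith
  have hs2 : a • r + b • t < t := by
    simp only [smul_eq_mul]; nlinarith
  have h := hf r _ t hr0 hs1 hs2
  have e1 : (t - (a • r + b • t)) / (t - r) = a := by
    rw [div_eq_iff hd.ne']
    simp only [smul_eq_mul]
    linear_combination -t * hab
  have e2 : (a • r + b • t - r) / (t - r) = b := by
    rw [div_eq_iff hd.ne']
    simp only [smul_eq_mul]
    linear_combination r * hab
  rw [e1, e2] at h
  have hl := Real.log_le_log (hpos _ (hr0.trans hs1.le)) h
  rw [Real.log_mul (Real.rpow_pos_of_pos (hpos r hr0) _).ne'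
    (Real.rpow_pos_of_pos (hpos t ht0) _).ne', Real.log_rpow (hpos r hr0),
    Real.log_rpow (hpos t ht0)] at hl
  simpa only [smul_eq_mul] using hl

lemma logConvex_of_convexOn_log {f : ℝ → ℝ} (hpos : ∀ t, 0 ≤ t → 0 < f t)
    (hf : ConvexOn ℝ (Ici 0) (fun t => Real.log (f t))) : LogConvexOnHalfLine f := by
  intro r s t hr hrs hst
  have hd : 0 < t - r := by linarith
  have ht : 0 ≤ t := by linarith
  have hs : 0 ≤ s := by linarith
  have h := hf.2 (mem_Ici.2 hr) (mem_Ici.2 ht)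
    (div_nonneg (sub_nonneg.2 hst.le) hd.le) (div_nonneg (sub_nonneg.2 hrs.le) hd.le)
    (by field_simp; ring)
  have e : ((t - s) / (t - r)) • r + ((s - r) / (t - r)) • t = s := by
    simp only [smul_eq_mul]
    field_simp
    ring
  rw [e] at h
  simp only [smul_eq_mul] at h
  rw [← Real.log_rpow (hpos r hr), ← Real.log_rpow (hpos t ht), ← Real.log_mul
    (Real.rpow_pos_of_pos (hpos r hr) _).ne' (Real.rpow_pos_of_pos (hpos t ht) _).ne'] at h
  exact (Real.log_le_log_iff (hpos s hs) (mul_pos (Real.rpow_pos_of_pos (hpos r hr) _)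
    (Real.rpow_pos_of_pos (hpos t ht) _))).1 h

/-- A positive, injective function with convex logarithm is strictly convex. -/
lemma strictConvexOn_of_convexOn_log {f : ℝ → ℝ} {s : Set ℝ} (hpos : ∀ t ∈ s, 0 < f t)
    (hinj : InjOn f s) (hf : ConvexOn ℝ s (fun t => Real.log (f t))) : StrictConvexOn ℝ s f := by
  refine ⟨hf.1, fun x hx y hy hxy a b ha hb hab => ?_⟩
  have hz := hf.1 hx hy ha.le hb.le hab
  -- Convexity of `log f` alone allows exponentials of constants; injectivity separates the
  -- logarithms, so strict convexity of `exp` supplies the strict inequality.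
  have hne : Real.log (f x) ≠ Real.log (f y) := fun h =>
    hxy (hinj hx hy (Real.log_injOn_pos (hpos x hx) (hpos y hy) h))
  have h1 := strictConvexOn_exp.2 (mem_univ _) (mem_univ _) hne ha hb hab
  rw [Real.exp_log (hpos x hx), Real.exp_log (hpos y hy)] at h1
  refine lt_of_le_of_lt ?_ h1
  rw [← Real.log_le_iff_le_exp (hpos _ hz)]
  exact hf.2 hx hy ha.le hb.le hab

/-- A convex function on the half-line, differentiable in the interior, has an extended right
derivative at the endpoint, which is the infimum of its derivatives. -/
lemma exists_extendedRightDeriv {f : ℝ → ℝ} (hf : ConvexOn ℝ (Ici 0) f)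
    (hc : ContinuousOn f (Ici 0)) (hd : DifferentiableOn ℝ f (Ioi 0)) :
    ∃ L : EReal, HasExtendedRightDeriv f L 0 ∧
      L = ⨅ t : Ioi (0 : ℝ), ((deriv f t : ℝ) : EReal) := by
  -- In `EReal` every set is bounded below, so the monotone quotients converge to their infimum,
  -- possibly `⊥`.
  have hmono : MonotoneOn (fun t : ℝ => (((f t - f 0) / (t - 0) : ℝ) : EReal)) (Ioi 0) := by
    intro s hs t ht hst
    have h := hf.slope_mono (mem_Ici.2 le_rfl) ⟨mem_Ici.2 (le_of_lt hs), (ne_of_gt hs : s ≠ 0)⟩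
      ⟨mem_Ici.2 (le_of_lt ht), (ne_of_gt ht : t ≠ 0)⟩ hst
    rw [slope_def_field, slope_def_field] at h
    exact EReal.coe_le_coe_iff.2 h
  refine ⟨_, hmono.tendsto_nhdsGT (OrderBot.bddBelow _), le_antisymm ?_ ?_⟩
  · refine le_iInf fun t => sInf_le_of_le (mem_image_of_mem _ t.2) (EReal.coe_le_coe_iff.2 ?_)
    rw [← slope_def_field]
    exact hf.slope_le_of_hasDerivAt (mem_Ici.2 le_rfl) (mem_Ici.2 (le_of_lt t.2)) t.2
      (hd.differentiableAt (Ioi_mem_nhds t.2)).hasDerivAt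
  · refine le_sInf ?_
    rintro _ ⟨t, ht, rfl⟩
    -- By the mean value theorem each quotient is itself a value of `f'`.
    obtain ⟨c, hc1, hc2⟩ := exists_deriv_eq_slope f (mem_Ioi.1 ht)
      (hc.mono Icc_subset_Ici_self) (hd.mono Ioo_subset_Ioi_self)
    refine (iInf_le _ (⟨c, hc1.1⟩ : Ioi (0 : ℝ))).trans (EReal.coe_le_coe_iff.2 ?_)
    exact hc2.le

end Convexity

/-! ### Analyticity, nonvanishing and generator calculus for orbits. -/

section Orbit

variable {H : Type*} [NormedAddCommGroup H] [InnerProductSpace ℂ H]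

/-- The bound on `δ` keeps the sector off the negative axis, where `arg` is discontinuous. -/
lemma isOpen_sector {δ : ℝ} (hδ : δ < Real.pi / 2) : IsOpen (sector δ) := by
  rw [isOpen_iff_mem_nhds]
  rintro z ⟨hz, hza⟩
  have hs : z ∈ Complex.slitPlane := by
    rw [Complex.mem_slitPlane_iff_arg]
    refine ⟨fun h => ?_, hz⟩
    rw [h, abs_of_pos Real.pi_pos] at hza
    linarith [Real.pi_pos]
  have h1 : ∀ᶠ w in 𝓝 z, |w.arg| < δ :=
    (Complex.continuousAt_arg hs).abs.eventually (gt_mem_nhds hza)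
  filter_upwards [h1, isOpen_ne.mem_nhds hz] with w hw hw0 using ⟨hw0, hw⟩

lemma ofReal_mem_sector {δ t : ℝ} (hδ : 0 < δ) (ht : 0 < t) : (t : ℂ) ∈ sector δ :=
  ⟨Complex.ofReal_ne_zero.2 ht.ne', by rwa [Complex.arg_ofReal_of_nonneg ht.le, abs_zero]⟩

variable {T : ℂ → H →L[ℂ] H} {δ : ℝ}

lemma IsHolomorphicOn.map_add_apply (hT : IsHolomorphicOn T δ) (hδ : 0 < δ) {s t : ℝ}
    (hs : 0 < s) (ht : 0 < t) (x : H) :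
    T ((s + t : ℝ) : ℂ) x = T (s : ℂ) (T (t : ℂ) x) := by
  rw [Complex.ofReal_add, hT.map_add _ (ofReal_mem_sector hδ hs) _ (ofReal_mem_sector hδ ht)]
  rfl

lemma IsHolomorphicOn.map_zero_apply (hT : IsHolomorphicOn T δ) (x : H) :
    T ((0 : ℝ) : ℂ) x = x := by
  rw [Complex.ofReal_zero, hT.map_zero]
  rfl

lemma IsHolomorphicOn.tendsto_orbit_zero (hT : IsHolomorphicOn T δ) (hδ : 0 < δ) (x : H) :
    Tendsto (fun t : ℝ => T (t : ℂ) x) (𝓝[>] 0) (𝓝 x) := by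
  refine (hT.tendsto_zero x).comp (tendsto_nhdsWithin_iff.2 ⟨?_, ?_⟩)
  · exact (Complex.continuous_ofReal.tendsto' 0 0 Complex.ofReal_zero).mono_left
      nhdsWithin_le_nhds
  · filter_upwards [self_mem_nhdsWithin] with t ht using ofReal_mem_sector hδ ht

variable {A : H →ₗ.[ℂ] H}

/-- Translation by `s` acts as `T s`, so the right difference quotients of `f` at `t` are those
defining the generator at `f t`. Used both for an orbit and for its derivative. -/
lemma IsGenerator.mem_domain (hA : IsGenerator (-A) T) {f : ℝ → H} {y : H} {t : ℝ}
    (hf : HasDerivAt f y t) (hfT : ∀ s, 0 < s → f (t + s) = T (s : ℂ) (f t)) :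
    ∃ hx : f t ∈ A.domain, A ⟨f t, hx⟩ = -y := by
  obtain ⟨hx, hxy⟩ := (hA (f t) y).2 (by
    refine ((hasDerivAt_iff_tendsto_slope_zero.1 hf).mono_left
      (nhdsWithin_mono _ fun s hs => ne_of_gt hs)).congr' ?_
    filter_upwards [self_mem_nhdsWithin] with s hs
    rw [hfT s hs])
  refine ⟨hx, ?_⟩
  rw [← hxy, LinearPMap.neg_apply, neg_neg]

lemma IsGenerator.tendsto (hA : IsGenerator (-A) T) (x : A.domain) :
    Tendsto (fun t : ℝ => t⁻¹ • (T (t : ℂ) x - x)) (𝓝[>] 0) (𝓝 (-A x)) :=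
  (hA x (-A x)).1 ⟨x.2, LinearPMap.neg_apply A x⟩

lemma IsGenerator.hasDerivWithinAt_orbit_zero (hA : IsGenerator (-A) T)
    (hT : IsHolomorphicOn T δ) (x : A.domain) :
    HasDerivWithinAt (fun t : ℝ => T (t : ℂ) (x : H)) (-A x) (Ici 0) 0 := by
  rw [← hasDerivWithinAt_Ioi_iff_Ici, hasDerivWithinAt_iff_tendsto_slope' (self_notMem_Ioi)]
  refine (hA.tendsto x).congr fun t => ?_
  rw [slope_def_module, hT.map_zero_apply, sub_zero]

variable [CompleteSpace H]

lemma IsHolomorphicOn.analyticOnNhd_orbit (hT : IsHolomorphicOn T δ) (hδ : 0 < δ)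
    (hδ' : δ < Real.pi / 2) (x : H) :
    AnalyticOnNhd ℝ (fun t : ℝ => T (t : ℂ) x) (Ioi 0) := by
  intro t ht
  have h1 : DifferentiableOn ℂ (fun z => T z x) (sector δ) := fun z hz =>
    ((hT.holomorphic z hz).clm_apply (differentiableWithinAt_const x))
  have h2 : AnalyticAt ℂ (fun z => T z x) (Complex.ofRealCLM t) :=
    h1.analyticAt ((isOpen_sector hδ').mem_nhds (ofReal_mem_sector hδ ht))
  exact (h2.restrictScalars (𝕜 := ℝ)).comp (Complex.ofRealCLM.analyticAt t)

lemma IsHolomorphicOn.continuousOn_orbit (hT : IsHolomorphicOn T δ) (hδ : 0 < δ)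
    (hδ' : δ < Real.pi / 2) (x : H) :
    ContinuousOn (fun t : ℝ => T (t : ℂ) x) (Ici 0) := by
  intro t ht
  rcases (mem_Ici.1 ht).eq_or_lt with rfl | ht
  · rw [← continuousWithinAt_Ioi_iff_Ici]
    exact (hT.tendsto_orbit_zero hδ x).trans_eq (congrArg 𝓝 (hT.map_zero_apply x).symm)
  · exact (hT.analyticOnNhd_orbit hδ hδ' x t ht).continuousAt.continuousWithinAt

/-- An orbit that vanishes once vanishes at all later times, hence on `(0, ∞)` by the identity
theorem; strong continuity at `0` then forces `x = 0`. -/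
lemma IsHolomorphicOn.orbit_ne_zero (hT : IsHolomorphicOn T δ) (hδ : 0 < δ)
    (hδ' : δ < Real.pi / 2) {x : H} (hx : x ≠ 0) {t : ℝ} (ht : 0 ≤ t) : T (t : ℂ) x ≠ 0 := by
  rcases ht.eq_or_lt with rfl | ht
  · rwa [hT.map_zero_apply]
  intro h0
  have hlater : ∀ s : ℝ, t < s → T (s : ℂ) x = 0 := fun s hs => by
    have := hT.map_add_apply hδ (sub_pos.2 hs) ht x
    rwa [sub_add_cancel, h0, _root_.map_zero] at this
  have hz := (hT.analyticOnNhd_orbit hδ hδ' x).eqOn_zero_of_preconnected_of_eventuallyEq_zero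
    isPreconnected_Ioi (z₀ := t + 1) (mem_Ioi.2 (by linarith)) (by
      filter_upwards [lt_mem_nhds (lt_add_one t)] with s hs using hlater s hs)
  refine hx (tendsto_nhds_unique (hT.tendsto_orbit_zero hδ x) ?_)
  refine tendsto_const_nhds.congr' ?_
  filter_upwards [self_mem_nhdsWithin] with s hs using (hz hs).symm

lemma IsHolomorphicOn.hasDerivAt_orbit (hT : IsHolomorphicOn T δ) (hδ : 0 < δ)
    (hδ' : δ < Real.pi / 2) (x : H) {t : ℝ} (ht : 0 < t) :
    HasDerivAt (fun t : ℝ => T (t : ℂ) x) (deriv (fun t : ℝ => T (t : ℂ) x) t) t :=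
  (hT.analyticOnNhd_orbit hδ hδ' x t ht).differentiableAt.hasDerivAt

lemma IsHolomorphicOn.hasDerivAt_deriv_orbit (hT : IsHolomorphicOn T δ) (hδ : 0 < δ)
    (hδ' : δ < Real.pi / 2) (x : H) {t : ℝ} (ht : 0 < t) :
    HasDerivAt (deriv (fun t : ℝ => T (t : ℂ) x))
      (deriv (deriv (fun t : ℝ => T (t : ℂ) x)) t) t :=
  ((hT.analyticOnNhd_orbit hδ hδ' x).deriv t ht).differentiableAt.hasDerivAt

lemma IsHolomorphicOn.deriv_orbit_add (hT : IsHolomorphicOn T δ) (hδ : 0 < δ)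
    (hδ' : δ < Real.pi / 2) (x : H) {s t : ℝ} (hs : 0 < s) (ht : 0 < t) :
    deriv (fun t : ℝ => T (t : ℂ) x) (t + s) =
      T (s : ℂ) (deriv (fun t : ℝ => T (t : ℂ) x) t) := by
  have h1 := (hT.hasDerivAt_orbit hδ hδ' x (add_pos ht hs)).comp_add_const t s
  have h2 := ((T (s : ℂ)).restrictScalars ℝ).hasFDerivAt.comp_hasDerivAt t
    (hT.hasDerivAt_orbit hδ hδ' x ht)
  refine h1.unique (h2.congr_of_eventuallyEq ?_)
  filter_upwards [lt_mem_nhds ht] with r hr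
  rw [add_comm]
  exact hT.map_add_apply hδ hs hr x

lemma IsGenerator.orbit_mem_domain (hA : IsGenerator (-A) T) (hT : IsHolomorphicOn T δ)
    (hδ : 0 < δ) (hδ' : δ < Real.pi / 2) (x : H) {t : ℝ} (ht : 0 < t) :
    ∃ hx : T (t : ℂ) x ∈ A.domain,
      A ⟨T (t : ℂ) x, hx⟩ = -deriv (fun t : ℝ => T (t : ℂ) x) t := by
  refine hA.mem_domain (hT.hasDerivAt_orbit hδ hδ' x ht) fun s hs => ?_
  rw [add_comm]
  exact hT.map_add_apply hδ hs ht x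

lemma IsGenerator.deriv_orbit_mem_domain (hA : IsGenerator (-A) T) (hT : IsHolomorphicOn T δ)
    (hδ : 0 < δ) (hδ' : δ < Real.pi / 2) (x : H) {t : ℝ} (ht : 0 < t) :
    ∃ hx : deriv (fun t : ℝ => T (t : ℂ) x) t ∈ A.domain,
      A ⟨_, hx⟩ = -deriv (deriv (fun t : ℝ => T (t : ℂ) x)) t :=
  hA.mem_domain (hT.hasDerivAt_deriv_orbit hδ hδ' x ht) fun _ hs =>
    hT.deriv_orbit_add hδ hδ' x hs ht

/-- The bounded operator `T t` passes through the limit defining `A x`; a right derivative suffices,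
since the orbit is already known to be differentiable. -/
lemma IsGenerator.deriv_orbit (hA : IsGenerator (-A) T) (hT : IsHolomorphicOn T δ)
    (hδ : 0 < δ) (hδ' : δ < Real.pi / 2) (x : A.domain) {t : ℝ} (ht : 0 < t) :
    deriv (fun t : ℝ => T (t : ℂ) (x : H)) t = -T (t : ℂ) (A x) := by
  have h1 := (hasDerivAt_iff_tendsto_slope_zero.1
    (hT.hasDerivAt_orbit hδ hδ' (x : H) ht)).mono_left (y := 𝓝[>] (0 : ℝ))
      (nhdsWithin_mono (0 : ℝ) fun s hs => ne_of_gt hs)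
  have h2 := ((T (t : ℂ)).continuous.tendsto _).comp (hA.tendsto x)
  rw [map_neg] at h2
  refine tendsto_nhds_unique h1 (h2.congr' ?_)
  filter_upwards [self_mem_nhdsWithin] with s hs
  rw [hT.map_add_apply hδ ht hs, ← map_sub]
  exact ((T (t : ℂ)).restrictScalars ℝ).map_smul _ _

end Orbit

/-! ### Equivalence of the criterion with convexity of `log h`. -/

section Criterion

variable {H : Type*} [NormedAddCommGroup H] [InnerProductSpace ℂ H]
  {T : ℂ → H →L[ℂ] H} {δ : ℝ} {A : H →ₗ.[ℂ] H}

/-- Both sides scale with degree four, so the unit-vector criterion applies to `x / ‖x‖`. -/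
lemma LogConvexityCriterion.inner_sq_le (h : LogConvexityCriterion A) {x y z : H} (hx0 : x ≠ 0)
    (hx : ∃ hx : x ∈ A.domain, A ⟨x, hx⟩ = y) (hy : ∃ hy : y ∈ A.domain, A ⟨y, hy⟩ = z) :
    2 * inner ℝ x y ^ 2 ≤ (inner ℝ x z + ‖y‖ ^ 2) * ‖x‖ ^ 2 := by
  obtain ⟨hxA, rfl⟩ := hx
  obtain ⟨hyA, rfl⟩ := hy
  have hn : 0 < ‖x‖ := norm_pos_iff.2 hx0
  set c : ℝ := ‖x‖⁻¹ with hc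
  have e1 : A ((c : ℂ) • ⟨x, hxA⟩) = (c : ℂ) • A ⟨x, hxA⟩ := A.map_smul _ _
  have hm : A ((c : ℂ) • ⟨x, hxA⟩) ∈ A.domain := by
    rw [e1]; exact A.domain.smul_mem _ hyA
  have e2 : A ⟨A ((c : ℂ) • ⟨x, hxA⟩), hm⟩ = (c : ℂ) • A ⟨_, hyA⟩ := by
    rw [← A.map_smul]
    congr 1
    exact Subtype.ext e1
  have h1 := h ((c : ℂ) • ⟨x, hxA⟩) hm (by
    rw [Submodule.coe_smul, norm_smul, Complex.norm_real, Real.norm_of_nonneg (by positivity)]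
    exact inv_mul_cancel₀ hn.ne')
  rw [e2, e1, Submodule.coe_smul, inner_smul_left, inner_smul_right, inner_smul_left,
    inner_smul_right, Complex.conj_ofReal, Complex.re_ofReal_mul, Complex.re_ofReal_mul,
    Complex.re_ofReal_mul, Complex.re_ofReal_mul, norm_smul, Complex.norm_real,
    Real.norm_of_nonneg (by positivity)] at h1
  rw [real_inner_eq_re_inner ℂ, real_inner_eq_re_inner ℂ]
  simp only [RCLike.re_to_complex]
  have hcx : c * ‖x‖ = 1 := inv_mul_cancel₀ hn.ne'
  have h2 := mul_le_mul_of_nonneg_right h1 (by positivity : 0 ≤ ‖x‖ ^ 4)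
  calc _ = 2 * (c * (c * (inner ℂ x (A ⟨x, hxA⟩)).re)) ^ 2 * ‖x‖ ^ 4 := by
        linear_combination (-2 * (inner ℂ x (A ⟨x, hxA⟩)).re ^ 2) *
          (c * ‖x‖ + 1) * (c ^ 2 * ‖x‖ ^ 2 + 1) * hcx
    _ ≤ _ := h2
    _ = _ := by
        linear_combination ((inner ℂ x (A ⟨A ⟨x, hxA⟩, hyA⟩)).re + ‖A ⟨x, hxA⟩‖ ^ 2) * ‖x‖ ^ 2 *
          (c * ‖x‖ + 1) * hcx

variable [CompleteSpace H]

lemma LogConvexityCriterion.convexOn_log_height (h : LogConvexityCriterion A)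
    (hA : IsGenerator (-A) T) (hT : IsHolomorphicOn T δ) (hδ : 0 < δ) (hδ' : δ < Real.pi / 2)
    {x : H} (hx : x ≠ 0) : ConvexOn ℝ (Ici 0) (fun t => Real.log (height T x t)) := by
  have hne : ∀ {t : ℝ}, 0 ≤ t → T (t : ℂ) x ≠ 0 := hT.orbit_ne_zero hδ hδ' hx
  refine convexOn_of_hasDerivWithinAt2_nonneg (convex_Ici 0)
    ((hT.continuousOn_orbit hδ hδ' x).norm.log fun t ht => norm_ne_zero_iff.2 (hne ht)) ?_ ?_ ?_
    (f' := fun t => inner ℝ (T (t : ℂ) x) (deriv (fun t : ℝ => T (t : ℂ) x) t) /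
      ‖T (t : ℂ) x‖ ^ 2)
    (f'' := fun t => ((inner ℝ (T (t : ℂ) x) (deriv (deriv (fun t : ℝ => T (t : ℂ) x)) t) +
        ‖deriv (fun t : ℝ => T (t : ℂ) x) t‖ ^ 2) * ‖T (t : ℂ) x‖ ^ 2 -
      2 * inner ℝ (T (t : ℂ) x) (deriv (fun t : ℝ => T (t : ℂ) x) t) ^ 2) /
        (‖T (t : ℂ) x‖ ^ 2) ^ 2)
  · rw [interior_Ici]
    exact fun t ht => (hasDerivAt_log_norm (hT.hasDerivAt_orbit hδ hδ' x ht)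
      (hne (le_of_lt ht))).hasDerivWithinAt
  · rw [interior_Ici]
    exact fun t ht => (hasDerivAt_inner_div_norm_sq (hT.hasDerivAt_orbit hδ hδ' x ht)
      (hT.hasDerivAt_deriv_orbit hδ hδ' x ht) (hne (le_of_lt ht))).hasDerivWithinAt
  · rw [interior_Ici]
    intro t ht
    refine div_nonneg ?_ (by positivity)
    obtain ⟨hv, hv'⟩ := hA.deriv_orbit_mem_domain hT hδ hδ' x ht
    -- Here `Au = -u'` and `A(-u') = u''`; the sign of `u'` disappears in the squares.
    have h1 := h.inner_sq_le (hne (le_of_lt ht)) (hA.orbit_mem_domain hT hδ hδ' x ht)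
      (z := deriv (deriv (fun t : ℝ => T (t : ℂ) x)) t)
      ⟨A.domain.neg_mem hv, by
        rw [← neg_neg (deriv (deriv (fun t : ℝ => T (t : ℂ) x)) t), ← hv', ← A.map_neg]
        rfl⟩
    rw [inner_neg_right, neg_sq, norm_neg] at h1
    linarith

/-- Convexity of `log ‖T t x‖` gives the differential inequality for the orbit at positive
times. -/
lemma IsHolomorphicOn.inner_sq_le_of_convexOn (hT : IsHolomorphicOn T δ) (hδ : 0 < δ)
    (hδ' : δ < Real.pi / 2) {x : H} (hx : x ≠ 0)
    (h : ConvexOn ℝ (Ici 0) (fun t => Real.log (height T x t))) {t : ℝ} (ht : 0 < t) :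
    2 * inner ℝ (T (t : ℂ) x) (deriv (fun t : ℝ => T (t : ℂ) x) t) ^ 2 ≤
      (inner ℝ (T (t : ℂ) x) (deriv (deriv (fun t : ℝ => T (t : ℂ) x)) t) +
        ‖deriv (fun t : ℝ => T (t : ℂ) x) t‖ ^ 2) * ‖T (t : ℂ) x‖ ^ 2 := by
  have hne : ∀ {t : ℝ}, 0 ≤ t → T (t : ℂ) x ≠ 0 := hT.orbit_ne_zero hδ hδ' hx
  have hd : ∀ s ∈ Ioi (0 : ℝ), HasDerivAt (fun t => Real.log (height T x t)) _ s := fun s hs =>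
    hasDerivAt_log_norm (hT.hasDerivAt_orbit hδ hδ' x hs) (hne (le_of_lt hs))
  have hm := (h.subset Ioi_subset_Ici_self (convex_Ioi 0)).monotoneOn_deriv
    fun s hs => (hd s hs).differentiableAt
  have h0 := hm.derivWithin_nonneg (x := t)
  have hd2 := (hasDerivAt_inner_div_norm_sq (hT.hasDerivAt_orbit hδ hδ' x ht)
      (hT.hasDerivAt_deriv_orbit hδ hδ' x ht) (hne ht.le)).congr_of_eventuallyEq
    (f₁ := deriv (fun t => Real.log (height T x t))) (by
      filter_upwards [lt_mem_nhds ht] with s hs using (hd s hs).deriv)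
  rw [derivWithin_of_mem_nhds (Ioi_mem_nhds ht), hd2.deriv] at h0
  have hp : 0 < (‖T (t : ℂ) x‖ ^ 2) ^ 2 := by
    have := norm_pos_iff.2 (hne ht.le)
    positivity
  rw [le_div_iff₀ hp, zero_mul] at h0
  linarith

lemma logConvexityCriterion_of_convexOn_log_height (hA : IsGenerator (-A) T)
    (hT : IsHolomorphicOn T δ) (hδ : 0 < δ) (hδ' : δ < Real.pi / 2)
    (h : ∀ x : H, x ≠ 0 → ConvexOn ℝ (Ici 0) (fun t => Real.log (height T x t))) :
    LogConvexityCriterion A := by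
  intro x hx hn
  have hx0 : (x : H) ≠ 0 := by rw [← norm_ne_zero_iff, hn]; exact one_ne_zero
  have hv : ∀ t : ℝ, 0 < t → deriv (fun t : ℝ => T (t : ℂ) (x : H)) t = -T (t : ℂ) (A x) :=
    fun t ht => hA.deriv_orbit hT hδ hδ' x ht
  have hw : ∀ t : ℝ, 0 < t → deriv (deriv (fun t : ℝ => T (t : ℂ) (x : H))) t =
      T (t : ℂ) (A ⟨A x, hx⟩) := fun t ht => by
    have e : deriv (fun t : ℝ => T (t : ℂ) (x : H)) =ᶠ[𝓝 t] fun t => -T (t : ℂ) (A x) := by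
      filter_upwards [lt_mem_nhds ht] with s hs using hv s hs
    rw [e.deriv_eq, deriv.fun_neg, hA.deriv_orbit hT hδ hδ' ⟨A x, hx⟩ ht, neg_neg]
  have hu0 := hT.tendsto_orbit_zero hδ (x : H)
  have hv0 := hT.tendsto_orbit_zero hδ (A x)
  have hw0 := hT.tendsto_orbit_zero hδ (A ⟨A x, hx⟩)
  -- For `x ∈ D(A²)` the derivatives are `-T t (Ax)` and `T t (A²x)`, which converge as `t → 0⁺`.
  have key := le_of_tendsto_of_tendsto
    (((hu0.inner hv0 (𝕜 := ℝ)).pow 2).const_mul 2)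
    (((hu0.inner hw0 (𝕜 := ℝ)).add (hv0.norm.pow 2)).mul (hu0.norm.pow 2)) (by
      filter_upwards [self_mem_nhdsWithin] with t ht
      have := hT.inner_sq_le_of_convexOn hδ hδ' hx0 (h x hx0) ht
      rwa [hv t ht, hw t ht, inner_neg_right, neg_sq, norm_neg] at this)
  rwa [hn, one_pow, mul_one, real_inner_eq_re_inner ℂ, real_inner_eq_re_inner ℂ] at key

end Criterion

/-! ### Monotonicity and regularity of the height function. -/

section Height

variable {H : Type*} [NormedAddCommGroup H] [InnerProductSpace ℂ H]
  {T : ℂ → H →L[ℂ] H} {δ : ℝ} {A : H →ₗ.[ℂ] H}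

lemma inner_div_mem_re_numericalRange {x y : H} (hx0 : x ≠ 0)
    (hx : ∃ hx : x ∈ A.domain, A ⟨x, hx⟩ = y) :
    ∃ z ∈ numericalRange A, z.re = inner ℝ x y / ‖x‖ ^ 2 := by
  obtain ⟨hxA, rfl⟩ := hx
  have hn : 0 < ‖x‖ := norm_pos_iff.2 hx0
  refine ⟨_, ⟨((‖x‖⁻¹ : ℝ) : ℂ) • ⟨x, hxA⟩, ?_, rfl⟩, ?_⟩
  · rw [Submodule.coe_smul, norm_smul, Complex.norm_real, Real.norm_of_nonneg (by positivity)]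
    exact inv_mul_cancel₀ hn.ne'
  · rw [A.map_smul, Submodule.coe_smul, inner_smul_left, inner_smul_right, Complex.conj_ofReal,
      Complex.re_ofReal_mul, Complex.re_ofReal_mul, real_inner_eq_re_inner ℂ, RCLike.re_to_complex]
    field_simp

lemma IsPositivelyAccretive.inner_pos (h : IsPositivelyAccretive A) {x y : H} (hx0 : x ≠ 0)
    (hx : ∃ hx : x ∈ A.domain, A ⟨x, hx⟩ = y) : 0 < inner ℝ x y := by
  obtain ⟨z, hz, hzr⟩ := inner_div_mem_re_numericalRange hx0 hx
  have h1 : 0 < z.re := h hz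
  have hn : 0 < ‖x‖ := norm_pos_iff.2 hx0
  rw [hzr] at h1
  exact (div_pos_iff_of_pos_right (by positivity)).1 h1

lemma lowerBound_le {x y : H} (hx0 : x ≠ 0) (hx : ∃ hx : x ∈ A.domain, A ⟨x, hx⟩ = y) :
    lowerBound A ≤ ((inner ℝ x y / ‖x‖ ^ 2 : ℝ) : EReal) := by
  obtain ⟨z, hz, hzr⟩ := inner_div_mem_re_numericalRange hx0 hx
  exact sInf_le ⟨z, hz, congrArg _ hzr⟩

lemma IsPositivelyAccretive.lowerBound_nonneg (h : IsPositivelyAccretive A) :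
    0 ≤ lowerBound A := by
  refine le_sInf ?_
  rintro _ ⟨z, hz, rfl⟩
  exact EReal.coe_nonneg.2 (le_of_lt (h hz))

variable [CompleteSpace H]

lemma IsHolomorphicOn.hasDerivAt_height (hT : IsHolomorphicOn T δ) (hδ : 0 < δ)
    (hδ' : δ < Real.pi / 2) {x : H} (hx : x ≠ 0) {t : ℝ} (ht : 0 < t) :
    HasDerivAt (height T x)
      (inner ℝ (T (t : ℂ) x) (deriv (fun t : ℝ => T (t : ℂ) x) t) / ‖T (t : ℂ) x‖) t := by
  rw [← hasDerivWithinAt_univ]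
  exact hasDerivWithinAt_norm (hT.hasDerivAt_orbit hδ hδ' x ht).hasDerivWithinAt
    (hT.orbit_ne_zero hδ hδ' hx ht.le)

lemma IsHolomorphicOn.contDiffOn_height (hT : IsHolomorphicOn T δ) (hδ : 0 < δ)
    (hδ' : δ < Real.pi / 2) {x : H} (hx : x ≠ 0) :
    ContDiffOn ℝ ∞ (height T x) (Ioi 0) :=
  ContDiffOn.norm ℝ ((hT.analyticOnNhd_orbit hδ hδ' x).contDiffOn
    (uniqueDiffOn_Ioi 0))
    fun _ ht => hT.orbit_ne_zero hδ hδ' hx (le_of_lt ht)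

lemma IsHolomorphicOn.continuousOn_height (hT : IsHolomorphicOn T δ) (hδ : 0 < δ)
    (hδ' : δ < Real.pi / 2) (x : H) : ContinuousOn (height T x) (Ici 0) :=
  (hT.continuousOn_orbit hδ hδ' x).norm

lemma IsHolomorphicOn.height_pos (hT : IsHolomorphicOn T δ) (hδ : 0 < δ)
    (hδ' : δ < Real.pi / 2) {x : H} (hx : x ≠ 0) {t : ℝ} (ht : 0 ≤ t) : 0 < height T x t :=
  norm_pos_iff.2 (hT.orbit_ne_zero hδ hδ' hx ht)

lemma IsPositivelyAccretive.deriv_height_neg (h : IsPositivelyAccretive A)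
    (hA : IsGenerator (-A) T) (hT : IsHolomorphicOn T δ) (hδ : 0 < δ) (hδ' : δ < Real.pi / 2)
    {x : H} (hx : x ≠ 0) {t : ℝ} (ht : 0 < t) : deriv (height T x) t < 0 := by
  have hne := hT.orbit_ne_zero hδ hδ' hx ht.le
  have h1 := h.inner_pos hne (hA.orbit_mem_domain hT hδ hδ' x ht)
  rw [inner_neg_right] at h1
  rw [(hT.hasDerivAt_height hδ hδ' hx ht).deriv]
  exact div_neg_of_neg_of_pos (by linarith) (norm_pos_iff.2 hne)

lemma IsPositivelyAccretive.strictAntiOn_height (h : IsPositivelyAccretive A)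
    (hA : IsGenerator (-A) T) (hT : IsHolomorphicOn T δ) (hδ : 0 < δ) (hδ' : δ < Real.pi / 2)
    {x : H} (hx : x ≠ 0) : StrictAntiOn (height T x) (Ici 0) := by
  refine strictAntiOn_of_deriv_neg (convex_Ici 0) (hT.continuousOn_height hδ hδ' x) fun t ht => ?_
  rw [interior_Ici] at ht
  exact h.deriv_height_neg hA hT hδ hδ' hx ht

/-- The quotient `-h'/h` is the real part of a point of `ν(A)`, so `h' ≤ -m(A) h`; now let `t → 0⁺`,
where `h → 1`. -/
lemma iInf_deriv_height_le (h : IsPositivelyAccretive A)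
    (hA : IsGenerator (-A) T) (hT : IsHolomorphicOn T δ) (hδ : 0 < δ) (hδ' : δ < Real.pi / 2)
    {x : H} (hx : ‖x‖ = 1) :
    ⨅ t : Ioi (0 : ℝ), ((deriv (height T x) t : ℝ) : EReal) ≤ -lowerBound A := by
  have hx0 : x ≠ 0 := by rw [← norm_ne_zero_iff, hx]; exact one_ne_zero
  have hlb : ∀ t : ℝ, 0 < t → lowerBound A ≤
      ((-deriv (height T x) t / height T x t : ℝ) : EReal) := fun t ht => by
    have hne := hT.orbit_ne_zero hδ hδ' hx0 ht.le
    refine (lowerBound_le hne (hA.orbit_mem_domain hT hδ hδ' x ht)).trans_eq ?_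
    have hn := norm_ne_zero_iff.2 hne
    rw [(hT.hasDerivAt_height hδ hδ' hx0 ht).deriv, inner_neg_right]
    unfold height
    congr 1
    field_simp
  have h0 := h.lowerBound_nonneg
  -- The bound is finite: accretivity gives `0 ≤ m(A)`, and the orbit at time `1` bounds it above.
  obtain ⟨m, hm⟩ : ∃ m : ℝ, lowerBound A = m :=
    ⟨_, (EReal.coe_toReal ((hlb 1 one_pos).trans_lt (EReal.coe_lt_top _)).ne
      ((EReal.bot_lt_zero.trans_le h0).ne')).symm⟩
  rw [hm] at hlb ⊢
  have hlim : Tendsto (fun t => ((-(m * height T x t) : ℝ) : EReal)) (𝓝[>] 0)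
      (𝓝 ((-(m * 1) : ℝ) : EReal)) := by
    refine (continuous_coe_real_ereal.tendsto _).comp (Tendsto.neg (Tendsto.const_mul m ?_))
    rw [← hx]
    exact (hT.tendsto_orbit_zero hδ x).norm
  rw [mul_one, EReal.coe_neg] at hlim
  refine ge_of_tendsto hlim ?_
  filter_upwards [self_mem_nhdsWithin] with t ht
  refine (iInf_le _ (⟨t, ht⟩ : Ioi (0 : ℝ))).trans (EReal.coe_le_coe_iff.2 ?_)
  have h1 := EReal.coe_le_coe_iff.1 (hlb t ht)
  rw [le_div_iff₀ (hT.height_pos hδ hδ' hx0 (le_of_lt ht))] at h1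
  linarith

/-- Writing the derivative through the orbit of `A x` gives one formula valid up to `t = 0` and
visibly continuous there, hence `C¹` regularity. -/
lemma IsGenerator.hasDerivWithinAt_height (hA : IsGenerator (-A) T) (hT : IsHolomorphicOn T δ)
    (hδ : 0 < δ) (hδ' : δ < Real.pi / 2) {x : A.domain} (hx : (x : H) ≠ 0) {t : ℝ} (ht : 0 ≤ t) :
    HasDerivWithinAt (height T x)
      (-(inner ℝ (T (t : ℂ) (x : H)) (T (t : ℂ) (A x)) / height T x t)) (Ici 0) t := by
  rcases ht.eq_or_lt with rfl | ht
  · have hd : HasDerivWithinAt (fun t : ℝ => T (t : ℂ) (x : H)) (-T ((0 : ℝ) : ℂ) (A x))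
        (Ici 0) 0 := by
      rw [hT.map_zero_apply]
      exact hA.hasDerivWithinAt_orbit_zero hT x
    refine (hasDerivWithinAt_norm hd (hT.orbit_ne_zero hδ hδ' hx le_rfl)).congr_deriv ?_
    rw [inner_neg_right, neg_div]
    rfl
  · refine (hT.hasDerivAt_height hδ hδ' hx ht).hasDerivWithinAt.congr_deriv ?_
    rw [hA.deriv_orbit hT hδ hδ' x ht, inner_neg_right, neg_div]
    rfl

lemma IsGenerator.hasDerivWithinAt_height_zero (hA : IsGenerator (-A) T)
    (hT : IsHolomorphicOn T δ) (hδ : 0 < δ) (hδ' : δ < Real.pi / 2) {x : A.domain}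
    (hx : ‖(x : H)‖ = 1) :
    HasDerivWithinAt (height T x) (-(inner ℂ (x : H) (A x)).re) (Ici 0) 0 := by
  have hx0 : (x : H) ≠ 0 := by rw [← norm_ne_zero_iff, hx]; exact one_ne_zero
  refine (hA.hasDerivWithinAt_height hT hδ hδ' hx0 le_rfl).congr_deriv ?_
  unfold height
  rw [hT.map_zero_apply, hT.map_zero_apply, hx, div_one, real_inner_eq_re_inner ℂ,
    RCLike.re_to_complex]

lemma IsGenerator.contDiffOn_one_height (hA : IsGenerator (-A) T) (hT : IsHolomorphicOn T δ)
    (hδ : 0 < δ) (hδ' : δ < Real.pi / 2) {x : A.domain} (hx : (x : H) ≠ 0) :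
    ContDiffOn ℝ 1 (height T x) (Ici 0) := by
  have hd : ∀ t ∈ Ici (0 : ℝ), HasDerivWithinAt (height T x) _ (Ici 0) t := fun t ht =>
    hA.hasDerivWithinAt_height hT hδ hδ' hx ht
  rw [contDiffOn_one_iff_derivWithin (uniqueDiffOn_Ici 0)]
  refine ⟨fun t ht => (hd t ht).differentiableWithinAt, ContinuousOn.congr ?_ fun t ht =>
    (hd t ht).derivWithin (uniqueDiffOn_Ici 0 t ht)⟩
  exact (((hT.continuousOn_orbit hδ hδ' (x : H)).inner (𝕜 := ℝ)
    (hT.continuousOn_orbit hδ hδ' (A x))).div (hT.continuousOn_height hδ hδ' x)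
      fun t ht => (hT.height_pos hδ hδ' hx ht).ne').neg

end Height

end HolSemigroup

theorem theorem1 {H : Type*} [NormedAddCommGroup H] [InnerProductSpace ℂ H] [CompleteSpace H]
    (A : H →ₗ.[ℂ] H) (T : ℂ → H →L[ℂ] H)
    (hT : HolSemigroup.IsBoundedHolomorphic T) (hA : HolSemigroup.IsGenerator (-A) T) :
    (HolSemigroup.LogConvexityCriterion A ↔
      ∀ u₀ : H, u₀ ≠ 0 → HolSemigroup.LogConvexOnHalfLine (HolSemigroup.height T u₀)) ∧
    (HolSemigroup.LogConvexityCriterion A → HolSemigroup.IsPositivelyAccretive A →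
      (∀ u₀ : H, u₀ ≠ 0 →
        StrictAntiOn (HolSemigroup.height T u₀) (Ici 0) ∧
        StrictConvexOn ℝ (Ici 0) (HolSemigroup.height T u₀) ∧
        DifferentiableOn ℝ (HolSemigroup.height T u₀) (Ioi 0) ∧
        ∃ L : EReal, L ≤ 0 ∧
          HolSemigroup.HasExtendedRightDeriv (HolSemigroup.height T u₀) L 0 ∧
          L = ⨅ t : Ioi (0 : ℝ), ((deriv (HolSemigroup.height T u₀) t : ℝ) : EReal) ∧
          (‖u₀‖ = 1 → L ≤ -HolSemigroup.lowerBound A)) ∧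
      (∀ u₀ : A.domain, ‖(u₀ : H)‖ = 1 →
        HasDerivWithinAt (HolSemigroup.height T u₀)
          (-(inner ℂ (u₀ : H) (A u₀)).re) (Ici 0) 0 ∧
        ContDiffOn ℝ 1 (HolSemigroup.height T u₀) (Ici 0) ∧
        ContDiffOn ℝ ∞ (HolSemigroup.height T u₀) (Ioi 0))) := by
  obtain ⟨⟨δ, hδ, hδ', hT⟩, -⟩ := hT
  refine ⟨⟨fun h u hu => ?_, fun h => ?_⟩, fun h hacc => ⟨fun u hu => ?_, fun u hu => ?_⟩⟩
  · exact HolSemigroup.logConvex_of_convexOn_log (fun t ht => hT.height_pos hδ hδ' hu ht)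
      (h.convexOn_log_height hA hT hδ hδ' hu)
  · exact HolSemigroup.logConvexityCriterion_of_convexOn_log_height hA hT hδ hδ' fun u hu =>
      HolSemigroup.convexOn_log_of_logConvex (fun t ht => hT.height_pos hδ hδ' hu ht) (h u hu)
  · have hanti := hacc.strictAntiOn_height hA hT hδ hδ' hu
    have hconv := HolSemigroup.strictConvexOn_of_convexOn_log
      (fun t ht => hT.height_pos hδ hδ' hu ht) hanti.injOn (h.convexOn_log_height hA hT hδ hδ' hu)
    have hdiff : DifferentiableOn ℝ (HolSemigroup.height T u) (Ioi 0) := fun t ht =>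
      (hT.hasDerivAt_height hδ hδ' hu ht).differentiableAt.differentiableWithinAt
    obtain ⟨L, hL, hLinf⟩ := HolSemigroup.exists_extendedRightDeriv hconv.convexOn
      (hT.continuousOn_height hδ hδ' u) hdiff
    refine ⟨hanti, hconv, hdiff, L, ?_, hL, hLinf, fun hn => ?_⟩
    · rw [hLinf]
      exact (iInf_le _ (⟨1, mem_Ioi.2 one_pos⟩ : Ioi (0 : ℝ))).trans
        (EReal.coe_nonpos.2 (hacc.deriv_height_neg hA hT hδ hδ' hu one_pos).le)
    · rw [hLinf]
      exact HolSemigroup.iInf_deriv_height_le hacc hA hT hδ hδ' hn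
  · have hu0 : (u : H) ≠ 0 := by rw [← norm_ne_zero_iff, hu]; exact one_ne_zero
    exact ⟨hA.hasDerivWithinAt_height_zero hT hδ hδ' hu, hA.contDiffOn_one_height hT hδ hδ' hu0,
      hT.contDiffOn_height hδ hδ' hu0⟩
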